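/- Let $N \ge 1$ be an integer, $p_1 \in (1,\infty)$ and $\theta \in (0,1)$. There exists a finite constant $C = C(N,p_1,\theta)$ such that the following holds for every $s_1 \in (0,1)$ with $s_1 p_1 \ge 1$. Let $s$ and $p$ be defined by $$s = \theta s_1 + (1-\theta), \qquad \frac1p = \frac{\theta}{p_1} + (1-\theta).$$ Then $0<s<1$, $1<p<\infty$, and for every real-valued $u \in C_c^\infty(\mathbb{R}^N)$, $$\left[\frac{u(x)-u(y)}{|x-y|^{\frac Np+s}}\right]_{L^{p,\frac{p_1}{\theta}}(\mathbb{R}^N\times\mathbb{R}^N)} \le C\, |u|_{W^{s_1,p_1}(\mathbb{R}^N)}^{\theta}\, \|\nabla u\|_{L^1(\mathbb{R}^N)}^{1-\theta}.$$ Here, for $1\le p,q<\infty$, the Lorentz quasinorm of a measurable function $f$ on $\mathbb{R}^N\times\mathbb{R}^N$ is given by $$[f]_{L^{p,q}(\mathbb{R}^N\times\mathbb{R}^N)}^q = p\int_0^\infty \lambda^q\, \mathcal{L}^{2N}\bigl(\{(x,y)\in\mathbb{R}^N\times\mathbb{R}^N : |f(x,y)|\ge\lambda\}\bigr)^{\frac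 qp}\,\frac{d\lambda}{\lambda},$$ where $\mathcal{L}^{2N}$ is Lebesgue measure, and the Gagliardo seminorm is given by $$|u|_{W^{s_1,p_1}(\mathbb{R}^N)}^{p_1} = \iint_{\mathbb{R}^N\times\mathbb{R}^N} \frac{|u(x)-u(y)|^{p_1}}{|x-y|^{N+s_1p_1}}\,dy\,dx.$$ -/

import Mathlib

open MeasureTheory
open scoped NNReal ContDiff

noncomputable section

/-- The Lorentz quasinorm with second index `q < ∞`, with values in `[0, ∞]`:
`(p ∫_0^∞ λ ^ q μ({|f| ≥ λ}) ^ (q / p) dλ / λ) ^ (1 / q)`. -/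
def lorentzQuasinorm {α : Type*} [MeasurableSpace α] (f : α → ℝ) (p q : ℝ) (μ : Measure α) :
    ENNReal :=
  (ENNReal.ofReal p *
    ∫⁻ t in Set.Ioi (0 : ℝ),
      ENNReal.ofReal (t ^ q) * μ {z | t ≤ |f z|} ^ (q / p) * ENNReal.ofReal (1 / t)) ^ (1 / q)

/-- The Gagliardo seminorm `|u|_{W^{s,p}}` on `ℝ^N`, with values in `[0, ∞]`:
`(∬ |u(x) - u(y)| ^ p / |x - y| ^ (N + s p) dy dx) ^ (1 / p)`. The convention at `x = y` is
irrelevant, as the diagonal is a null set for `N ≥ 1`. -/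
def gagliardoSeminorm {N : ℕ} (s p : ℝ) (u : EuclideanSpace ℝ (Fin N) → ℝ) : ENNReal :=
  (∫⁻ z : EuclideanSpace ℝ (Fin N) × EuclideanSpace ℝ (Fin N),
    ENNReal.ofReal (|u z.1 - u z.2| ^ p / ‖z.1 - z.2‖ ^ ((N : ℝ) + s * p))) ^ (1 / p)

end

/-! The exponents are arranged so that the quotient factors exactly: its absolute value is `A ^ θ *
B ^ (1 - θ)`, with `A = |u x - u y| / |x - y| ^ (N / p₁ + s₁)` and `B = |u x - u y| / |x - y| ^ (N +
1)`. The `L^{p₁}` norm of `A` is the Gagliardo seminorm, and `B` lies in weak `L¹` with bound a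
multiple of `‖∇u‖₁`. Hölder's inequality between `L^{p₁/θ}` and weak `L^{1/(1-θ)}` then gives the
claim, with a constant that does not see `s₁`.

The Hölder step (`lintegral_measure_rpow_le_of_le_mul_weak`) compares superlevel sets, opens the
power of the distribution function by layer cake, and rescales the level under Fubini.

The weak `L¹` bound (`measure_largeDifference_le`) reduces by polar coordinates in `y - x` to a
fixed direction. On each line, a Vitali covering by intervals with a large increment is paid for by
the integral of the derivative (`setLIntegral_largeDifference_le`). -/

/-! ### Scaling and layer-cake tools -/

theorem setLIntegral_Ioi_eq_mul_comp_mul_left {c : ℝ} (hc : 0 < c) (F : ℝ → ENNReal) :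
    ∫⁻ x in Set.Ioi (0 : ℝ), F x = ENNReal.ofReal c * ∫⁻ x in Set.Ioi (0 : ℝ), F (c * x) := by
  have hemb : MeasurableEmbedding (fun x : ℝ => c * x) :=
    (Homeomorph.mulLeft₀ c hc.ne').measurableEmbedding
  rw [← lintegral_indicator measurableSet_Ioi, ← lintegral_indicator measurableSet_Ioi]
  conv_lhs => rw [← Real.smul_map_volume_mul_left hc.ne', lintegral_smul_measure,
    hemb.lintegral_map, abs_of_pos hc, smul_eq_mul]
  congr 1
  refine lintegral_congr fun x => ?_
  by_cases hx : 0 < x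
  · simp [Set.indicator, hx, mul_pos hc hx]
  · simp [Set.indicator, hx, mul_pos_iff_of_pos_left hc]

/-- Layer cake for a constant function on a Dirac mass. Since `a` may be `⊤`, it is first done for
finite `b < a`, then passed to the supremum. -/
theorem ENNReal.rpow_le_mul_lintegral_indicator {r : ℝ} (hr : 0 < r) (a : ENNReal) :
    a ^ r ≤ ENNReal.ofReal r * ∫⁻ t in Set.Ioi (0 : ℝ),
      {t : ℝ | ENNReal.ofReal t < a}.indicator (fun t => ENNReal.ofReal (t ^ (r - 1))) t := by
  have key : ∀ b : ℝ≥0, (b : ENNReal) < a → (b : ENNReal) ^ r ≤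
      ENNReal.ofReal r * ∫⁻ t in Set.Ioi (0 : ℝ),
      {t : ℝ | ENNReal.ofReal t < a}.indicator (fun t => ENNReal.ofReal (t ^ (r - 1))) t := by
    intro b hb
    have h := lintegral_rpow_eq_lintegral_meas_le_mul (Measure.dirac ())
      (f := fun _ => (b : ℝ)) (Filter.Eventually.of_forall fun _ => b.2) aemeasurable_const hr
    have h1 : ENNReal.ofReal ((b : ℝ) ^ r) = (b : ENNReal) ^ r := by
      rw [← ENNReal.ofReal_rpow_of_nonneg b.coe_nonneg hr.le]; simp
    rw [lintegral_const, measure_univ, mul_one, h1] at h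
    rw [h]
    gcongr with t
    by_cases ht : t ≤ b
    · have : ENNReal.ofReal t < a := lt_of_le_of_lt (by
        rw [← ENNReal.ofReal_coe_nnreal]; exact ENNReal.ofReal_le_ofReal ht) hb
      simp [Set.indicator, ht, this]
    · simp [ht]
  rw [← ENNReal.le_rpow_inv_iff hr]
  refine ENNReal.le_of_forall_nnreal_lt fun b hb => ?_
  rw [ENNReal.le_rpow_inv_iff hr]
  exact key b hb

theorem volume_setOf_ofReal_half_lt_le (a : ENNReal) :
    volume ({t : ℝ | ENNReal.ofReal (t / 2) < a} ∩ Set.Ioi 0) ≤ 2 * a := by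
  induction a with
  | top => simp
  | coe a =>
    calc volume ({t : ℝ | ENNReal.ofReal (t / 2) < (a : ENNReal)} ∩ Set.Ioi 0)
        ≤ volume (Set.Ioc (0 : ℝ) (2 * a)) := by
          refine measure_mono fun t ht => ⟨ht.2, ?_⟩
          have h : ENNReal.ofReal (t / 2) < (a : ENNReal) := ht.1
          rw [← ENNReal.ofReal_coe_nnreal, ENNReal.ofReal_lt_ofReal_iff'] at h
          linarith [h.1]
      _ = 2 * (a : ENNReal) := by
          rw [Real.volume_Ioc, sub_zero, ENNReal.ofReal_mul zero_le_two]; simp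

/-! ### Hölder's inequality against weak `L¹` -/

section

variable {α : Type*} [MeasurableSpace α] {μ : Measure α}

theorem antitone_measure_le (μ : Measure α) (f : α → ℝ) : Antitone fun t : ℝ => μ {z | t ≤ f z} :=
  fun _ _ hst => measure_mono fun _ hz => le_trans hst hz

/-- Comparison of the superlevel sets of a product `A ^ θ * B ^ (1 - θ)`, with `B` in weak `L¹`,
and of `A ^ θ`. -/
theorem half_lt_measure_of_lt_measure {f A B : α → ℝ} {θ M t l : ℝ} (hθ₁ : θ < 1)
    (hA : ∀ z, 0 ≤ A z) (hB : ∀ z, 0 ≤ B z) (hf : ∀ z, f z ≤ A z ^ θ * B z ^ (1 - θ))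
    (hM : 0 < M) (hBM : ∀ b, 0 < b → μ {z | b ≤ B z} ≤ ENNReal.ofReal (M / b)) (ht : 0 < t)
    (h : ENNReal.ofReal t < μ {z | l ≤ f z}) :
    ENNReal.ofReal (t / 2) < μ {z | l / (2 * M / t) ^ (1 - θ) ≤ A z ^ θ} := by
  -- At height `2 * M / t` the weak bound on `B` gives measure at most `t / 2`, so the other half of
  -- `t` must come from `A`.
  have hc : 0 < (2 * M / t) ^ (1 - θ) := by positivity
  have hsub : {z | l ≤ f z} ⊆ {z | 2 * M / t ≤ B z} ∪ {z | l / (2 * M / t) ^ (1 - θ) ≤ A z ^ θ} := by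
    intro z hz
    by_cases hz' : 2 * M / t ≤ B z
    · exact Or.inl hz'
    · refine Or.inr ?_
      rw [Set.mem_ofPred_eq, div_le_iff₀ hc]
      refine (le_trans hz (hf z)).trans ?_
      have := hA z
      gcongr
      · exact hB z
      · exact (not_le.1 hz').le
  have h1 : μ {z | 2 * M / t ≤ B z} ≤ ENNReal.ofReal (t / 2) := by
    convert hBM (2 * M / t) (by positivity) using 2
    field_simp
  by_contra! hle
  have : μ {z | l ≤ f z} ≤ ENNReal.ofReal (t / 2) + ENNReal.ofReal (t / 2) :=
    (measure_mono hsub).trans ((measure_union_le _ _).trans (add_le_add h1 hle))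
  rw [← ENNReal.ofReal_add (by positivity) (by positivity), add_halves] at this
  exact absurd h (not_lt.2 this)

/-- Hölder's inequality in Lorentz spaces between `L^{θ q}` and weak `L¹`, in terms of the
distribution function. -/
theorem lintegral_measure_rpow_le_of_le_mul_weak {f A B : α → ℝ} {θ q M : ℝ} (hθ₀ : 0 < θ)
    (hθ₁ : θ < 1) (hq : 0 < q) (hA : ∀ z, 0 ≤ A z) (hB : ∀ z, 0 ≤ B z) (hAm : Measurable A)
    (hf : ∀ z, f z ≤ A z ^ θ * B z ^ (1 - θ)) (hM : 0 ≤ M)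
    (hBM : ∀ b, 0 < b → μ {z | b ≤ B z} ≤ ENNReal.ofReal (M / b)) :
    ∫⁻ l in Set.Ioi (0 : ℝ), ENNReal.ofReal (l ^ (q - 1)) *
        μ {z | l ≤ f z} ^ (1 + q * (1 - θ)) ≤
      ENNReal.ofReal ((1 + q * (1 - θ)) * (2 * M) ^ (q * (1 - θ)) * 2 / q) *
        ∫⁻ z, ENNReal.ofReal (A z ^ (θ * q)) ∂μ := by
  set r := q * (1 - θ) with hr
  have hr0 : 0 < r := mul_pos hq (by linarith)
  rcases hM.eq_or_lt with rfl | hM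
  -- For `M = 0` the scaling factor below would vanish; instead `B = 0` almost everywhere, so
  -- positive superlevel sets of `f` are null.
  · have hB0 : μ {z | 0 < B z} = 0 := by
      have : {z | 0 < B z} ⊆ ⋃ n : ℕ, {z | 1 / ((n : ℝ) + 1) ≤ B z} := by
        intro z hz
        obtain ⟨n, hn⟩ := exists_nat_one_div_lt (show 0 < B z from hz)
        exact Set.mem_iUnion.2 ⟨n, hn.le⟩
      refine measure_mono_null this (measure_iUnion_null fun n => ?_)
      simpa using hBM (1 / ((n : ℝ) + 1)) (by positivity)
    refine le_of_eq_of_le ?_ zero_le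
    refine (setLIntegral_congr_fun measurableSet_Ioi fun l (hl : 0 < l) => ?_).trans lintegral_zero
    have : μ {z | l ≤ f z} = 0 := by
      refine measure_mono_null (fun z hz => ?_) hB0
      by_contra hz0
      have : B z = 0 := le_antisymm (not_lt.1 hz0) (hB z)
      have h2 := le_trans hz (hf z)
      rw [this, Real.zero_rpow (by linarith), mul_zero] at h2
      linarith
    simp only [this]
    rw [ENNReal.zero_rpow_of_pos (by linarith), mul_zero]
  set m : ℝ → ENNReal := fun l => μ {z | l ≤ f z} with hm
  set D : ℝ → ENNReal := fun l => μ {z | l ≤ A z ^ θ} with hD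
  have hmm : Measurable m := (antitone_measure_le μ f).measurable
  have hDm : Measurable D := (antitone_measure_le μ fun z => A z ^ θ).measurable
  -- the integral for a fixed value of the rearrangement parameter
  have hfix : ∀ t : ℝ, 0 < t → ENNReal.ofReal (t ^ r) * ∫⁻ l in Set.Ioi (0 : ℝ),
      {l | ENNReal.ofReal t < m l}.indicator (fun l => ENNReal.ofReal (l ^ (q - 1))) l ≤
      ENNReal.ofReal ((2 * M) ^ r) * ∫⁻ l in Set.Ioi (0 : ℝ),
      {l | ENNReal.ofReal (t / 2) < D l}.indicator (fun l => ENNReal.ofReal (l ^ (q - 1))) l := by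
    intro t ht
    -- Rescaling `l` by `c` produces `c ^ q = (2 * M / t) ^ r`, whose dependence on `t` cancels the
    -- weight `t ^ r`.
    set c := (2 * M / t) ^ (1 - θ) with hcdef
    have hc : 0 < c := by positivity
    rw [setLIntegral_Ioi_eq_mul_comp_mul_left hc, ← mul_assoc,
      ← ENNReal.ofReal_mul (by positivity)]
    have hconst : (2 * M) ^ r = t ^ r * c * c ^ (q - 1) := by
      have h1 : c * c ^ (q - 1) = c ^ q := by
        rw [← Real.rpow_one_add' hc.le (by linarith)]; congr 1; ring
      rw [mul_assoc, h1, hcdef, ← Real.rpow_mul (by positivity), mul_comm (1 - θ) q, ← hr,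
        ← Real.mul_rpow ht.le (by positivity)]
      congr 1
      field_simp
    rw [hconst, ENNReal.ofReal_mul (p := t ^ r * c) (by positivity), mul_assoc]
    gcongr
    rw [← lintegral_const_mul' _ _ ENNReal.ofReal_ne_top]
    refine setLIntegral_mono' measurableSet_Ioi fun l (hl : 0 < l) => ?_
    by_cases h : ENNReal.ofReal t < m (c * l)
    · have h2 : ENNReal.ofReal (t / 2) < D l := by
        have := half_lt_measure_of_lt_measure hθ₁ hA hB hf hM hBM ht h
        rwa [← hcdef, mul_div_cancel_left₀ _ hc.ne'] at this
      rw [Set.indicator_of_mem (show c * l ∈ {l | ENNReal.ofReal t < m l} from h),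
        Set.indicator_of_mem (show l ∈ {l | ENNReal.ofReal (t / 2) < D l} from h2),
        ← ENNReal.ofReal_mul (by positivity), Real.mul_rpow hc.le hl.le]
    · rw [Set.indicator_of_notMem (show c * l ∉ {l | ENNReal.ofReal t < m l} from h)]
      exact zero_le
  have hlast : ∫⁻ z, ENNReal.ofReal (A z ^ (θ * q)) ∂μ =
      ENNReal.ofReal q * ∫⁻ l in Set.Ioi (0 : ℝ), D l * ENNReal.ofReal (l ^ (q - 1)) := by
    rw [← lintegral_rpow_eq_lintegral_meas_le_mul μ (f := fun z => A z ^ θ)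
      (Filter.Eventually.of_forall fun z => Real.rpow_nonneg (hA z) _)
      (hAm.pow_const _).aemeasurable hq]
    simp_rw [Real.rpow_mul (hA _)]
  calc ∫⁻ l in Set.Ioi (0 : ℝ), ENNReal.ofReal (l ^ (q - 1)) * m l ^ (1 + r)
      ≤ ∫⁻ l in Set.Ioi (0 : ℝ), ENNReal.ofReal (l ^ (q - 1)) * (ENNReal.ofReal (1 + r) *
        ∫⁻ t in Set.Ioi (0 : ℝ), {t : ℝ | ENNReal.ofReal t < m l}.indicator
          (fun t => ENNReal.ofReal (t ^ r)) t) := by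
        gcongr with l
        have := ENNReal.rpow_le_mul_lintegral_indicator (r := 1 + r) (by linarith) (m l)
        rwa [add_sub_cancel_left] at this
    _ = ENNReal.ofReal (1 + r) * ∫⁻ l in Set.Ioi (0 : ℝ), ∫⁻ t in Set.Ioi (0 : ℝ),
          {p : ℝ × ℝ | ENNReal.ofReal p.2 < m p.1}.indicator
          (fun p => ENNReal.ofReal (p.2 ^ r) * ENNReal.ofReal (p.1 ^ (q - 1))) (l, t) := by
        rw [← lintegral_const_mul' _ _ ENNReal.ofReal_ne_top]
        refine lintegral_congr fun l => ?_
        rw [mul_left_comm, ← lintegral_const_mul' _ _ ENNReal.ofReal_ne_top]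
        congr 1
        refine lintegral_congr fun t => ?_
        simp only [Set.indicator, Set.mem_ofPred_eq]
        split_ifs
        · rw [mul_comm]
        · simp
    _ = ENNReal.ofReal (1 + r) * ∫⁻ t in Set.Ioi (0 : ℝ), ∫⁻ l in Set.Ioi (0 : ℝ),
          {p : ℝ × ℝ | ENNReal.ofReal p.2 < m p.1}.indicator
          (fun p => ENNReal.ofReal (p.2 ^ r) * ENNReal.ofReal (p.1 ^ (q - 1))) (l, t) := by
        rw [lintegral_lintegral_swap]
        refine Measurable.aemeasurable (Measurable.indicator (by fun_prop) ?_)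
        exact measurableSet_lt (by fun_prop) (by fun_prop)
    _ ≤ ENNReal.ofReal (1 + r) * ∫⁻ t in Set.Ioi (0 : ℝ), ENNReal.ofReal ((2 * M) ^ r) *
          ∫⁻ l in Set.Ioi (0 : ℝ), {p : ℝ × ℝ | ENNReal.ofReal (p.1 / 2) < D p.2}.indicator
          (fun p => ENNReal.ofReal (p.2 ^ (q - 1))) (t, l) := by
        gcongr 1
        refine setLIntegral_mono' measurableSet_Ioi fun t (ht : 0 < t) => ?_
        refine le_trans (le_of_eq ?_) (hfix t ht)
        rw [← lintegral_const_mul' _ _ ENNReal.ofReal_ne_top]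
        refine lintegral_congr fun l => ?_
        simp only [Set.indicator, Set.mem_ofPred_eq]
        split_ifs <;> simp
    _ = ENNReal.ofReal ((1 + r) * (2 * M) ^ r) * ∫⁻ l in Set.Ioi (0 : ℝ),
          ∫⁻ t in Set.Ioi (0 : ℝ), {p : ℝ × ℝ | ENNReal.ofReal (p.1 / 2) < D p.2}.indicator
          (fun p => ENNReal.ofReal (p.2 ^ (q - 1))) (t, l) := by
        rw [lintegral_const_mul' _ _ ENNReal.ofReal_ne_top, ← mul_assoc,
          ← ENNReal.ofReal_mul (by linarith), lintegral_lintegral_swap]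
        refine Measurable.aemeasurable (Measurable.indicator (by fun_prop) ?_)
        exact measurableSet_lt (by fun_prop) (by fun_prop)
    _ ≤ ENNReal.ofReal ((1 + r) * (2 * M) ^ r) * ∫⁻ l in Set.Ioi (0 : ℝ),
          2 * (D l * ENNReal.ofReal (l ^ (q - 1))) := by
        gcongr with l
        have : ∀ t, {p : ℝ × ℝ | ENNReal.ofReal (p.1 / 2) < D p.2}.indicator
          (fun p => ENNReal.ofReal (p.2 ^ (q - 1))) (t, l) =
          {t : ℝ | ENNReal.ofReal (t / 2) < D l}.indicator
            (fun _ => ENNReal.ofReal (l ^ (q - 1))) t := fun t => rfl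
        simp_rw [this]
        have hms : MeasurableSet {t : ℝ | ENNReal.ofReal (t / 2) < D l} :=
          measurableSet_lt (by fun_prop) (by fun_prop)
        rw [lintegral_indicator_const hms, Measure.restrict_apply hms, mul_comm, ← mul_assoc]
        gcongr
        exact volume_setOf_ofReal_half_lt_le _
    _ = _ := by
        rw [lintegral_const_mul' _ _ (by simp), hlast, ← mul_assoc, ← mul_assoc,
          ← ENNReal.ofReal_mul (by positivity)]
        have : (2 : ENNReal) = ENNReal.ofReal 2 := by simp
        rw [this, ← ENNReal.ofReal_mul (by positivity)]
        congr 2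
        field_simp

end

/-! ### Vitali covering on a line -/

/-- One-dimensional covering estimate: weighted measure of the set of pairs `(t, t + r)` with a
large difference quotient of order `n + 2`. -/
theorem setLIntegral_largeDifference_le {v : ℝ → ℝ} {f : ℝ → ENNReal} {l R T : ℝ} (n : ℕ)
    (hvf : ∀ a b, a ≤ b → ENNReal.ofReal |v b - v a| ≤ ∫⁻ t in Set.Icc a b, f t)
    (hl : 0 < l) :
    ∫⁻ z in {z : ℝ × ℝ | z.1 ∈ Set.Icc 0 T ∧ z.2 ∈ Set.Ioc 0 R ∧
        l * z.2 ^ (n + 2) ≤ |v (z.1 + z.2) - v z.1|}, ENNReal.ofReal (z.2 ^ n) ≤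
      ENNReal.ofReal (5 ^ (n + 2) / l) * ∫⁻ t in Set.Icc 0 (T + R), f t := by
  set S := {z : ℝ × ℝ | z.1 ∈ Set.Icc 0 T ∧ z.2 ∈ Set.Ioc 0 R ∧
        l * z.2 ^ (n + 2) ≤ |v (z.1 + z.2) - v z.1|} with hS
  obtain ⟨U, hUS, hdisj, hcov⟩ := Vitali.exists_disjoint_subfamily_covering_enlargement_closedBall
    S (fun z => z.1 + z.2 / 2) (fun z => z.2 / 2) (R / 2)
    (fun z hz => by have := hz.2.1.2; linarith) 5 (by norm_num)
  have hball : ∀ z : ℝ × ℝ, Metric.closedBall (z.1 + z.2 / 2) (z.2 / 2) =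
      Set.Icc z.1 (z.1 + z.2) := by
    intro z; rw [Real.closedBall_eq_Icc]; congr 1 <;> ring
  have hcount : U.Countable := by
    refine hdisj.countable_of_nonempty_interior fun z hz => ?_
    have hz2 := (hUS hz).2.1.1
    rw [hball, interior_Icc]
    exact Set.nonempty_Ioo.2 (by linarith)
  have : Countable U := hcount.to_subtype
  -- If `[t, t + r]` lies in the fivefold enlargement of `[z.1, z.1 + z.2]`, then `(t, r)` lies in
  -- this box. Its weighted measure is at most `(5 * z.2) ^ (n + 2)`, the power appearing in the
  -- definition of `S`.
  set Q : ℝ × ℝ → Set (ℝ × ℝ) := fun z =>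
    Set.Icc (z.1 - 2 * z.2) (z.1 + 3 * z.2) ×ˢ Set.Icc 0 (5 * z.2) with hQ
  have hSQ : S ⊆ ⋃ z : U, Q z := by
    intro z hz
    obtain ⟨b, hb, hzb⟩ := hcov z hz
    have hz2 := hz.2.1.1
    rw [hball, Real.closedBall_eq_Icc] at hzb
    have h1 := hzb (Set.left_mem_Icc.2 (by linarith))
    have h2 := hzb (Set.right_mem_Icc.2 (by linarith))
    refine Set.mem_iUnion.2 ⟨⟨b, hb⟩, ⟨⟨?_, ?_⟩, hz2.le, ?_⟩⟩ <;>
      simp only [Set.mem_Icc] at * <;> linarith [h1.1, h1.2, h2.1, h2.2]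
  have hbound : ∀ z ∈ U, ∫⁻ w in Q z, ENNReal.ofReal (w.2 ^ n) ≤
      ENNReal.ofReal (5 ^ (n + 2) / l) * ∫⁻ t in Set.Icc z.1 (z.1 + z.2), f t := by
    intro z hz
    obtain ⟨-, ⟨hz2, -⟩, hz3⟩ := hUS hz
    calc ∫⁻ w in Q z, ENNReal.ofReal (w.2 ^ n)
        ≤ ∫⁻ w in Q z, ENNReal.ofReal ((5 * z.2) ^ n) := by
          refine setLIntegral_mono' (measurableSet_Icc.prod measurableSet_Icc) fun w hw => ?_
          exact ENNReal.ofReal_le_ofReal (pow_le_pow_left₀ hw.2.1 hw.2.2 n)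
      _ = ENNReal.ofReal (5 ^ (n + 2) / l) * ENNReal.ofReal (l * z.2 ^ (n + 2)) := by
          rw [setLIntegral_const, hQ, Measure.volume_eq_prod, Measure.prod_prod, Real.volume_Icc,
            Real.volume_Icc, ← ENNReal.ofReal_mul (by linarith), ← ENNReal.ofReal_mul (by positivity),
            ← ENNReal.ofReal_mul (by positivity)]
          congr 1
          field_simp
          ring
      _ ≤ _ := by
          gcongr
          refine (ENNReal.ofReal_le_ofReal hz3).trans (hvf _ _ (by linarith))
  calc ∫⁻ w in S, ENNReal.ofReal (w.2 ^ n)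
      ≤ ∫⁻ w in ⋃ z : U, Q z, ENNReal.ofReal (w.2 ^ n) := lintegral_mono_set hSQ
    _ ≤ ∑' z : U, ∫⁻ w in Q z, ENNReal.ofReal (w.2 ^ n) := lintegral_iUnion_le _ _
    _ ≤ ∑' z : U, ENNReal.ofReal (5 ^ (n + 2) / l) *
          ∫⁻ t in Set.Icc z.1.1 (z.1.1 + z.1.2), f t :=
        ENNReal.tsum_le_tsum fun z => hbound z z.2
    _ = ENNReal.ofReal (5 ^ (n + 2) / l) *
          ∫⁻ t in ⋃ z ∈ U, Set.Icc z.1 (z.1 + z.2), f t := by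
        rw [ENNReal.tsum_mul_left, lintegral_biUnion hcount (fun _ _ => measurableSet_Icc)]
        intro a ha b hb hab
        have := hdisj ha hb hab
        simpa only [Function.onFun, hball] using this
    _ ≤ _ := by
        gcongr
        refine Set.iUnion₂_subset fun z hz => Set.Icc_subset_Icc (hUS hz).1.1 ?_
        exact add_le_add (hUS hz).1.2 (hUS hz).2.1.2

/-! ### Weak `L¹` bound in several dimensions -/

section

variable {E : Type*} [NormedAddCommGroup E] [NormedSpace ℝ E]

theorem ofReal_abs_sub_le_lintegral_enorm_fderiv {u : E → ℝ} (hu : ContDiff ℝ 1 u) (x : E) {w : E}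
    (hw : ‖w‖ ≤ 1) {a b : ℝ} (hab : a ≤ b) :
    ENNReal.ofReal |u (x + b • w) - u (x + a • w)| ≤
      ∫⁻ t in Set.Icc a b, ‖fderiv ℝ u (x + t • w)‖ₑ := by
  have hline : ∀ t : ℝ, HasDerivAt (fun t : ℝ => x + t • w) w t := fun t => by
    simpa using ((hasDerivAt_id t).smul_const w).const_add x
  have hcd : ContDiff ℝ 1 fun t : ℝ => u (x + t • w) := hu.comp (by fun_prop)
  have h := enorm_sub_le_lintegral_deriv_of_contDiffOn_Icc hcd.contDiffOn hab
  rw [← Real.norm_eq_abs, ofReal_norm]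
  refine h.trans ?_
  refine lintegral_mono fun t => ?_
  have hd : HasDerivAt (fun t : ℝ => u (x + t • w)) (fderiv ℝ u (x + t • w) w) t :=
    ((hu.differentiable one_ne_zero _).hasFDerivAt).comp_hasDerivAt t (hline t)
  rw [hd.deriv, enorm_le_iff_norm_le]
  exact (ContinuousLinearMap.le_opNorm _ _).trans (mul_le_of_le_one_right (norm_nonneg _) hw)

variable [MeasurableSpace E] [BorelSpace E] [FiniteDimensional ℝ E]
  (μ : Measure E) [μ.IsAddHaarMeasure]

/-- The line estimate is applied on `x + ℝ w` with base parameter in `[0, R]` and integrated over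
`x`. By translation invariance the left side gains a factor `R` and the right side `2 * R`;
cancelling `R` leaves the factor 2. -/
theorem lintegral_measure_largeDifference_le {u : E → ℝ} (hu : ContDiff ℝ 1 u) {K : ℝ}
    (hK : ∀ x, |u x| ≤ K) {w : E} (hw : ‖w‖ ≤ 1) {l : ℝ} (hl : 0 < l) (n : ℕ) :
    ∫⁻ r in Set.Ioi (0 : ℝ), ENNReal.ofReal (r ^ n) *
        μ {x | l * r ^ (n + 2) ≤ |u (x + r • w) - u x|} ≤
      ENNReal.ofReal (2 * 5 ^ (n + 2) / l) * ∫⁻ x, ‖fderiv ℝ u x‖ₑ ∂μ := by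
  have hK0 : 0 ≤ K := (abs_nonneg _).trans (hK 0)
  -- Boundedness of `u` caps admissible lengths: for `r > R`, `l * r ^ (n + 2) ≥ l * r > 2 * K`.
  set R := max 1 (2 * K / l) with hR
  have hR0 : 0 < R := lt_of_lt_of_le one_pos (le_max_left _ _)
  have hrR : ∀ x r, 0 < r → l * r ^ (n + 2) ≤ |u (x + r • w) - u x| → r ≤ R := by
    intro x r hr h
    by_contra! hlt
    have h1 : 1 ≤ r := (le_max_left _ _).trans hlt.le
    have h2 : 2 * K / l < r := (le_max_right _ _).trans_lt hlt
    have h3 : r ≤ r ^ (n + 2) := le_self_pow₀ h1 (by omega)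
    rw [div_lt_iff₀ hl] at h2
    have h4 : |u (x + r • w) - u x| ≤ 2 * K :=
      (abs_sub _ _).trans (by linarith [hK (x + r • w), hK x])
    nlinarith
  have hcu := hu.continuous
  have hcd : Continuous (fderiv ℝ u) := hu.continuous_fderiv one_ne_zero
  set P : E → ℝ × ℝ → Prop := fun x z =>
    z.1 ∈ Set.Icc 0 R ∧ z.2 ∈ Set.Ioc 0 R ∧
        l * z.2 ^ (n + 2) ≤ |u (x + (z.1 + z.2) • w) - u (x + z.1 • w)| with hP
  have hPm : MeasurableSet {q : E × ℝ × ℝ | P q.1 q.2} := by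
    apply MeasurableSet.inter
    · exact measurableSet_Icc.preimage (by fun_prop)
    apply MeasurableSet.inter
    · exact measurableSet_Ioc.preimage (by fun_prop)
    have : MeasurableSet {q : E × ℝ × ℝ | l * q.2.2 ^ (n + 2) ≤
        |u (q.1 + (q.2.1 + q.2.2) • w) - u (q.1 + q.2.1 • w)|} :=
      measurableSet_le (by fun_prop) (by fun_prop)
    exact this
  set F : E × ℝ × ℝ → ENNReal :=
    {q : E × ℝ × ℝ | P q.1 q.2}.indicator fun q => ENNReal.ofReal (q.2.2 ^ n) with hF
  have hFm : Measurable F := Measurable.indicator (by fun_prop) hPm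
  have hPx : ∀ x, MeasurableSet {z | P x z} := fun x => hPm.preimage measurable_prodMk_left
  have hPz : ∀ z, MeasurableSet {x | P x z} := fun z => hPm.preimage measurable_prodMk_right
  have hFx : ∀ x, ∫⁻ z, F (x, z) ≤
      ENNReal.ofReal (5 ^ (n + 2) / l) * ∫⁻ t in Set.Icc 0 (R + R), ‖fderiv ℝ u (x + t • w)‖ₑ := by
    intro x
    have h := setLIntegral_largeDifference_le (v := fun t => u (x + t • w)) (R := R) (T := R) n
      (fun a b hab => ofReal_abs_sub_le_lintegral_enorm_fderiv hu x hw hab) hl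
    exact (lintegral_indicator (hPx x) _).trans_le h
  have hFz : ∀ z : ℝ × ℝ, ∫⁻ x, F (x, z) ∂μ = (Set.Icc 0 R).indicator 1 z.1 *
      (Set.Ioi 0).indicator (fun r => ENNReal.ofReal (r ^ n) *
        μ {x | l * r ^ (n + 2) ≤ |u (x + r • w) - u x|}) z.2 := by
    intro z
    by_cases h1 : z.1 ∈ Set.Icc 0 R
    swap
    · have : ∀ x, F (x, z) = 0 := fun x => Set.indicator_of_notMem (fun h => h1 h.1) _
      simp [this, Set.indicator_of_notMem h1]
    by_cases h2 : z.2 ∈ Set.Ioi 0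
    swap
    · have : ∀ x, F (x, z) = 0 := fun x => Set.indicator_of_notMem (fun h => h2 h.2.1.1) _
      simp only [this, Set.indicator_of_notMem h2, lintegral_zero, mul_zero]
    rw [Set.indicator_of_mem h1, Set.indicator_of_mem h2, Pi.one_apply, one_mul]
    have hset : {x | P x z} = (fun x => x + z.1 • w) ⁻¹'
        {x | l * z.2 ^ (n + 2) ≤ |u (x + z.2 • w) - u x|} := by
      ext x
      simp only [hP, Set.mem_ofPred_eq, Set.mem_preimage]
      rw [add_smul, ← add_assoc]
      refine ⟨fun h => h.2.2, fun h => ⟨h1, ⟨h2, hrR _ _ h2 h⟩, h⟩⟩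
    calc ∫⁻ x, F (x, z) ∂μ = ∫⁻ x, {x | P x z}.indicator
          (fun _ => ENNReal.ofReal (z.2 ^ n)) x ∂μ := rfl
      _ = _ := by
        rw [lintegral_indicator_const (hPz z), hset, measure_preimage_add_right]
  set G := ∫⁻ r in Set.Ioi (0 : ℝ), ENNReal.ofReal (r ^ n) *
        μ {x | l * r ^ (n + 2) ≤ |u (x + r • w) - u x|} with hG
  have hmeas : Measurable fun r : ℝ => μ {x | l * r ^ (n + 2) ≤ |u (x + r • w) - u x|} := by
    have : MeasurableSet {q : ℝ × E | l * q.1 ^ (n + 2) ≤ |u (q.2 + q.1 • w) - u q.2|} :=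
      (isClosed_le (by fun_prop) (by fun_prop)).measurableSet
    exact measurable_measure_prodMk_left this
  have hleft : ∫⁻ z : ℝ × ℝ, ∫⁻ x, F (x, z) ∂μ = ENNReal.ofReal R * G := by
    simp_rw [hFz]
    rw [Measure.volume_eq_prod, lintegral_prod_mul, lintegral_indicator_one measurableSet_Icc,
      lintegral_indicator measurableSet_Ioi, Real.volume_Icc, sub_zero]
    · exact (measurable_one.indicator measurableSet_Icc).aemeasurable
    · exact (Measurable.indicator (Measurable.mul (by fun_prop) hmeas) measurableSet_Ioi).aemeasurable
  have hright : ∫⁻ x, (∫⁻ t in Set.Icc 0 (R + R), ‖fderiv ℝ u (x + t • w)‖ₑ) ∂μ =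
      ENNReal.ofReal (R + R) * ∫⁻ x, ‖fderiv ℝ u x‖ₑ ∂μ := by
    rw [lintegral_lintegral_swap]
    · have : ∀ t : ℝ, ∫⁻ x, ‖fderiv ℝ u (x + t • w)‖ₑ ∂μ = ∫⁻ x, ‖fderiv ℝ u x‖ₑ ∂μ :=
        fun t => lintegral_add_right_eq_self (fun x => ‖fderiv ℝ u x‖ₑ) (t • w)
      simp_rw [this]
      rw [setLIntegral_const, Real.volume_Icc, sub_zero, mul_comm]
    · have : Continuous fun q : E × ℝ => fderiv ℝ u (q.1 + q.2 • w) := by fun_prop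
      exact this.enorm.measurable.aemeasurable
  have hmain : ENNReal.ofReal R * G ≤ ENNReal.ofReal R *
      (ENNReal.ofReal (2 * 5 ^ (n + 2) / l) * ∫⁻ x, ‖fderiv ℝ u x‖ₑ ∂μ) := by
    calc ENNReal.ofReal R * G = ∫⁻ x, (∫⁻ z, F (x, z)) ∂μ := by
          rw [← hleft, lintegral_lintegral_swap]
          exact (hFm.comp measurable_swap).aemeasurable
      _ ≤ ∫⁻ x, (ENNReal.ofReal (5 ^ (n + 2) / l) *
          ∫⁻ t in Set.Icc 0 (R + R), ‖fderiv ℝ u (x + t • w)‖ₑ) ∂μ := lintegral_mono hFx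
      _ = _ := by
          rw [lintegral_const_mul' _ _ ENNReal.ofReal_ne_top, hright, ← mul_assoc, ← mul_assoc,
            ← ENNReal.ofReal_mul (by positivity), ← ENNReal.ofReal_mul (by positivity)]
          congr 2
          ring
  exact (ENNReal.mul_le_mul_iff_right (by simpa using hR0) ENNReal.ofReal_ne_top).1 hmain

theorem lintegral_eq_lintegral_toSphere [Nontrivial E] {g : E → ENNReal} (hg : Measurable g) :
    ∫⁻ h, g h ∂μ = ∫⁻ w : Metric.sphere (0 : E) 1, (∫⁻ r in Set.Ioi (0 : ℝ),
      ENNReal.ofReal (r ^ (Module.finrank ℝ E - 1)) * g (r • (w : E))) ∂μ.toSphere := by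
  have hmp := μ.measurePreserving_homeomorphUnitSphereProd
  have hemb := (homeomorphUnitSphereProd E).measurableEmbedding
  calc ∫⁻ h, g h ∂μ = ∫⁻ h in ({0}ᶜ : Set E), g h ∂μ := by rw [restrict_compl_singleton]
    _ = ∫⁻ h : ({0}ᶜ : Set E), g h ∂(μ.comap Subtype.val) :=
        (lintegral_subtype_comap (measurableSet_singleton 0).compl _).symm
    _ = ∫⁻ p : Metric.sphere (0 : E) 1 × Set.Ioi (0 : ℝ), g (p.2.1 • (p.1 : E))
          ∂(μ.toSphere.prod (Measure.volumeIoiPow (Module.finrank ℝ E - 1))) := by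
        rw [← hmp.lintegral_comp_emb hemb]
        refine lintegral_congr fun h => ?_
        have hh : ‖(h : E)‖ ≠ 0 := norm_ne_zero_iff.2 h.2
        simp [smul_smul, hh]
    _ = _ := by
        rw [lintegral_prod _ (Measurable.aemeasurable (by fun_prop))]
        refine lintegral_congr fun w => ?_
        rw [Measure.volumeIoiPow, lintegral_withDensity_eq_lintegral_mul _ (by fun_prop)
          (by fun_prop)]
        exact lintegral_subtype_comap measurableSet_Ioi
          fun r : ℝ => ENNReal.ofReal (r ^ (Module.finrank ℝ E - 1)) * g (r • (w : E))

/-- The weak `L¹` bound for the difference quotient `|u x - u y| / |x - y| ^ (N + 1)` of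
Brezis, Van Schaftingen and Yung. -/
theorem measure_largeDifference_le [Nontrivial E] {u : E → ℝ} (hu : ContDiff ℝ 1 u) {K : ℝ}
    (hK : ∀ x, |u x| ≤ K) {l : ℝ} (hl : 0 < l) :
    μ.prod μ {z : E × E | l ≤ |u z.1 - u z.2| / ‖z.1 - z.2‖ ^ (Module.finrank ℝ E + 1)} ≤
      μ.toSphere Set.univ * (ENNReal.ofReal (2 * 5 ^ (Module.finrank ℝ E + 1) / l) *
        ∫⁻ x, ‖fderiv ℝ u x‖ₑ ∂μ) := by
  have hcu := hu.continuous
  obtain ⟨n, hn⟩ : ∃ n, Module.finrank ℝ E = n + 1 :=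
    Nat.exists_eq_succ_of_ne_zero Module.finrank_pos.ne'
  rw [hn]
  set S := {z : E × E | l ≤ |u z.1 - u z.2| / ‖z.1 - z.2‖ ^ (n + 1 + 1)} with hS
  have hSm : MeasurableSet S := measurableSet_le (by fun_prop) (by fun_prop)
  have hSm' : MeasurableSet {z : E × E | (z.1, z.1 + z.2) ∈ S} :=
    hSm.preimage (by fun_prop)
  calc μ.prod μ S = ∫⁻ x, μ {y | (x, y) ∈ S} ∂μ := Measure.prod_apply hSm
    _ = ∫⁻ x, μ {h | (x, x + h) ∈ S} ∂μ := by
        refine lintegral_congr fun x => ?_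
        exact (measure_preimage_add μ x {y | (x, y) ∈ S}).symm
    _ = ∫⁻ h, μ {x | (x, x + h) ∈ S} ∂μ := by
        exact (Measure.prod_apply hSm').symm.trans (Measure.prod_apply_symm hSm')
    _ = ∫⁻ w : Metric.sphere (0 : E) 1, (∫⁻ r in Set.Ioi (0 : ℝ),
          ENNReal.ofReal (r ^ n) * μ {x | (x, x + r • (w : E)) ∈ S}) ∂μ.toSphere := by
        have := lintegral_eq_lintegral_toSphere μ (measurable_measure_prodMk_right (μ := μ) hSm')
        rwa [hn] at this
    _ ≤ ∫⁻ w : Metric.sphere (0 : E) 1, (ENNReal.ofReal (2 * 5 ^ (n + 2) / l) *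
          ∫⁻ x, ‖fderiv ℝ u x‖ₑ ∂μ) ∂μ.toSphere := by
        refine lintegral_mono fun w => ?_
        have hw : ‖(w : E)‖ = 1 := by simp
        refine le_trans ?_ (lintegral_measure_largeDifference_le μ hu hK hw.le hl n)
        refine setLIntegral_mono' measurableSet_Ioi fun r (hr : 0 < r) => ?_
        gcongr with x
        intro hx
        have : ‖x - (x + r • (w : E))‖ = r := by
          rw [sub_add_cancel_left, norm_neg, norm_smul, hw, mul_one, Real.norm_of_nonneg hr.le]
        simp only [hS, Set.mem_ofPred_eq, this] at hx
        rwa [le_div_iff₀ (by positivity), abs_sub_comm] at hx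
    _ = _ := by rw [lintegral_const, mul_comm]

end

/-! ### Factorization and conclusion -/

theorem div_rpow_eq_rpow_mul_rpow {a b θ m m₁ : ℝ} {n : ℕ} (ha : 0 ≤ a) (hb : 0 ≤ b)
    (hθ₀ : 0 < θ) (hθ₁ : θ < 1) (hm₁ : 0 ≤ m₁) (hm : m = θ * m₁ + (1 - θ) * n) :
    a / b ^ m = (a / b ^ m₁) ^ θ * (a / b ^ n) ^ (1 - θ) := by
  have hθ' : 0 < 1 - θ := by linarith
  rw [Real.div_rpow ha (by positivity), Real.div_rpow ha (by positivity), div_mul_div_comm,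
    ← Real.rpow_add_of_nonneg ha hθ₀.le hθ'.le, ← Real.rpow_natCast b n, ← Real.rpow_mul hb,
    ← Real.rpow_mul hb, ← Real.rpow_add_of_nonneg hb (by positivity) (by positivity), hm]
  simp only [add_sub_cancel, Real.rpow_one]
  ring_nf

theorem enorm_gradient {E : Type*} [NormedAddCommGroup E] [InnerProductSpace ℝ E] [CompleteSpace E]
    (u : E → ℝ) (x : E) : ‖gradient u x‖ₑ = ‖fderiv ℝ u x‖ₑ := by
  rw [← toDual_gradient, LinearIsometryEquiv.enorm_map]

/-- The relation `hpq` says `q / p = 1 + q * (1 - θ)`, so the prefactor `p` cancels against the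
Hölder constant. -/
theorem lorentzQuasinorm_le_of_abs_le_mul_weak {α : Type*} [MeasurableSpace α] {μ : Measure α}
    {f A B : α → ℝ} {θ p q M : ℝ} (hθ₀ : 0 < θ) (hθ₁ : θ < 1) (hq : 0 < q) (hp : 0 < p)
    (hpq : 1 / p = 1 / q + (1 - θ)) (hA : ∀ z, 0 ≤ A z) (hB : ∀ z, 0 ≤ B z) (hAm : Measurable A)
    (hf : ∀ z, |f z| ≤ A z ^ θ * B z ^ (1 - θ)) (hM : 0 ≤ M)
    (hBM : ∀ b, 0 < b → μ {z | b ≤ B z} ≤ ENNReal.ofReal (M / b)) :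
    lorentzQuasinorm f p q μ ≤
      (ENNReal.ofReal (2 * (2 * M) ^ (q * (1 - θ))) *
        ∫⁻ z, ENNReal.ofReal (A z ^ (θ * q)) ∂μ) ^ (1 / q) := by
  have hqp : q / p = 1 + q * (1 - θ) := by
    rw [div_eq_mul_one_div, hpq]
    field_simp
  have h := lintegral_measure_rpow_le_of_le_mul_weak hθ₀ hθ₁ hq hA hB hAm hf hM hBM
  rw [← hqp] at h
  refine ENNReal.rpow_le_rpow ?_ (by positivity)
  calc ENNReal.ofReal p * ∫⁻ t in Set.Ioi (0 : ℝ),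
        ENNReal.ofReal (t ^ q) * μ {z | t ≤ |f z|} ^ (q / p) * ENNReal.ofReal (1 / t)
      = ENNReal.ofReal p * ∫⁻ t in Set.Ioi (0 : ℝ),
        ENNReal.ofReal (t ^ (q - 1)) * μ {z | t ≤ |f z|} ^ (q / p) := by
        congr 1
        refine setLIntegral_congr_fun measurableSet_Ioi fun t (ht : 0 < t) => ?_
        rw [mul_right_comm, ← ENNReal.ofReal_mul (by positivity), Real.rpow_sub_one ht.ne',
          mul_one_div]
    _ ≤ ENNReal.ofReal p * _ := mul_le_mul' le_rfl h
    _ = _ := by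
        rw [← mul_assoc, ← ENNReal.ofReal_mul hp.le]
        congr 2
        field_simp

theorem theorem5 (N : ℕ) (hN : 1 ≤ N) (p₁ θ : ℝ) (hp₁ : 1 < p₁) (hθ₀ : 0 < θ) (hθ₁ : θ < 1) :
    ∃ C : ℝ≥0, ∀ s₁ : ℝ, 0 < s₁ → s₁ < 1 → 1 ≤ s₁ * p₁ →
      ∀ s p : ℝ, s = θ * s₁ + (1 - θ) → 1 / p = θ / p₁ + (1 - θ) →
        (0 < s ∧ s < 1) ∧ 1 < p ∧
        ∀ u : EuclideanSpace ℝ (Fin N) → ℝ, ContDiff ℝ ∞ u → HasCompactSupport u →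
          lorentzQuasinorm
              (fun z : EuclideanSpace ℝ (Fin N) × EuclideanSpace ℝ (Fin N) =>
                (u z.1 - u z.2) / ‖z.1 - z.2‖ ^ ((N : ℝ) / p + s))
              p (p₁ / θ) volume
            ≤ (C : ENNReal) * gagliardoSeminorm s₁ p₁ u ^ θ *
                eLpNorm (gradient u) 1 volume ^ (1 - θ) := by
  have hθ' : 0 < 1 - θ := by linarith
  have hp₁0 : 0 < p₁ := by linarith
  have hq : 0 < p₁ / θ := by positivity
  set S := (volume : Measure (EuclideanSpace ℝ (Fin N))).toSphere Set.univ with hS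
  have hStop : S ≠ ⊤ := measure_ne_top _ _
  set κ := S.toReal * (2 * 5 ^ (N + 1)) with hκ
  have hκ0 : 0 ≤ κ := by positivity
  set r := p₁ / θ * (1 - θ) with hr
  have hr0 : 0 < r := by positivity
  -- The weak bound will be `M = κ * ‖∇u‖₁`; as `r * (θ / p₁) = 1 - θ`, the gradient norm splits off
  -- with the right power.
  refine ⟨((2 * (2 * κ) ^ r) ^ (1 / (p₁ / θ))).toNNReal, fun s₁ hs₁ hs₁' _ s p hs hp => ?_⟩
  have hpinv : 0 < 1 / p := by rw [hp]; positivity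
  have hp0 : 0 < p := one_div_pos.1 hpinv
  have hp1 : 1 < p := by
    have h1 : θ / p₁ < θ := div_lt_self hθ₀ hp₁
    have : 1 / p < 1 := by linarith
    rwa [div_lt_one hp0] at this
  refine ⟨⟨by rw [hs]; positivity, by rw [hs]; nlinarith⟩, hp1, fun u hu hsupp => ?_⟩
  have hu1 : ContDiff ℝ 1 u := hu.of_le (by simp)
  have hcu := hu1.continuous
  have : NeZero N := ⟨by omega⟩
  obtain ⟨K, hK⟩ := hsupp.exists_bound_of_continuous hcu
  have hfin : ∫⁻ x, ‖fderiv ℝ u x‖ₑ ≠ ⊤ :=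
    (((hu1.continuous_fderiv one_ne_zero).integrable_of_hasCompactSupport
      (hsupp.fderiv ℝ)).hasFiniteIntegral).ne
  have hgrad : eLpNorm (gradient u) 1 volume = ∫⁻ x, ‖fderiv ℝ u x‖ₑ := by
    rw [eLpNorm_one_eq_lintegral_enorm]
    exact lintegral_congr fun x => enorm_gradient u x
  set I := (∫⁻ x, ‖fderiv ℝ u x‖ₑ).toReal with hI
  have hIeq : ∫⁻ x, ‖fderiv ℝ u x‖ₑ = ENNReal.ofReal I := (ENNReal.ofReal_toReal hfin).symm
  have hI0 : 0 ≤ I := ENNReal.toReal_nonneg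
  set m₁ := (N : ℝ) / p₁ + s₁ with hm₁
  have hm₁0 : 0 ≤ m₁ := by positivity
  set A : EuclideanSpace ℝ (Fin N) × EuclideanSpace ℝ (Fin N) → ℝ :=
    fun z => |u z.1 - u z.2| / ‖z.1 - z.2‖ ^ m₁ with hA
  set B : EuclideanSpace ℝ (Fin N) × EuclideanSpace ℝ (Fin N) → ℝ :=
    fun z => |u z.1 - u z.2| / ‖z.1 - z.2‖ ^ (N + 1) with hB
  have hBM : ∀ b, 0 < b → volume {z | b ≤ B z} ≤ ENNReal.ofReal (κ * I / b) := by
    intro b hb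
    have h := measure_largeDifference_le volume hu1 hK hb
    rw [finrank_euclideanSpace_fin] at h
    refine h.trans (le_of_eq ?_)
    rw [hIeq, ← hS, ← ENNReal.ofReal_toReal hStop, ← ENNReal.ofReal_mul (by positivity),
      ← ENNReal.ofReal_mul (by positivity)]
    congr 1
    rw [hκ]
    ring
  have hmain := lorentzQuasinorm_le_of_abs_le_mul_weak (μ := volume) (A := A) (B := B)
    (f := fun z => (u z.1 - u z.2) / ‖z.1 - z.2‖ ^ ((N : ℝ) / p + s)) hθ₀ hθ₁ hq hp0
    (by rw [hp, one_div_div]) (fun z => by positivity) (fun z => by positivity)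
    (by fun_prop) (fun z => ?_) (by positivity) hBM
  · refine hmain.trans (le_of_eq ?_)
    have hJ : ∫⁻ z, ENNReal.ofReal (A z ^ (θ * (p₁ / θ))) =
        ∫⁻ z : EuclideanSpace ℝ (Fin N) × EuclideanSpace ℝ (Fin N),
        ENNReal.ofReal (|u z.1 - u z.2| ^ p₁ / ‖z.1 - z.2‖ ^ ((N : ℝ) + s₁ * p₁)) := by
      refine lintegral_congr fun z => ?_
      rw [mul_div_cancel₀ _ hθ₀.ne', hA, Real.div_rpow (by positivity) (by positivity),
        ← Real.rpow_mul (by positivity)]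
      congr 4
      rw [hm₁]
      field_simp
    rw [hJ, hgrad, hIeq, gagliardoSeminorm]
    set J := ∫⁻ z : EuclideanSpace ℝ (Fin N) × EuclideanSpace ℝ (Fin N),
        ENNReal.ofReal (|u z.1 - u z.2| ^ p₁ / ‖z.1 - z.2‖ ^ ((N : ℝ) + s₁ * p₁))
    have hconst : 2 * (2 * (κ * I)) ^ r = (2 * (2 * κ) ^ r) * I ^ r := by
      rw [← mul_assoc 2 κ I, Real.mul_rpow (by positivity) hI0]
      ring
    have hexp : r * (1 / (p₁ / θ)) = 1 - θ := by
      rw [hr]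
      field_simp
    rw [hconst, ENNReal.ofReal_mul (by positivity), ENNReal.mul_rpow_of_nonneg _ _ (by positivity),
      ENNReal.mul_rpow_of_nonneg _ _ (by positivity), ENNReal.ofReal_rpow_of_nonneg (by positivity)
      (by positivity), ← ENNReal.ofReal_rpow_of_nonneg hI0 hr0.le, ← ENNReal.rpow_mul,
      ← ENNReal.rpow_mul, hexp, mul_right_comm, one_div_div, one_div_mul_eq_div]
    rfl
  · rw [abs_div, abs_of_nonneg (by positivity : 0 ≤ ‖z.1 - z.2‖ ^ ((N : ℝ) / p + s))]
    refine (div_rpow_eq_rpow_mul_rpow (abs_nonneg _) (norm_nonneg _) hθ₀ hθ₁ hm₁0 ?_).le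
    rw [div_eq_mul_one_div, hp, hm₁, hs]
    push_cast
    ring
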